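/- Let $k,n\ge 0$ be integers. For $t\in\mathbb C$ let $\mathcal P_k(t)$ be the partition algebra: the $\mathbb C$-algebra with basis the set partitions of $\{1,\dots,k\}\cup\{1',\dots,k'\}$ and product $d\,d_1=t^{N}\,(d\circ d_1)$, where $d\circ d_1$ is the set partition obtained by placing the diagram of $d$ on top of that of $d_1$, identifying the bottom points of $d$ with the top points of $d_1$, and removing the middle points, and $N$ is the number of connected components that consist of middle points only. A permutation $\sigma\in\mathfrak S_k$ is identified with the set partition with blocks $\{\sigma(r),r'\}$, $1\le r\le k$; this embeds $\mathbb C\mathfrak S_k$ in $\mathcal P_k(t)$. Let $e_k=\frac1{k!}\sum_{\sigma\in\mathfrak S_k}\sigma$, an idempotent, and let $\mathcal{SP}_k(t)=e_k\mathcal P_k(t)e_k$ be the spherical partition algebra, with unit element $e_k$. Let $V_n$ be a complex vector space with basis $v_1,\dots,v_n$. The group $\mathfrak S_n$ acts on $V_n$ by $\sigma v_i=v_{\sigma(i)}$ and diagonally on $V_n^{\otimes k}$. The algebra $\mathcal P_k(n)$ (that is, $t=n$) acts on $V_n^{\otimes k}$ from the right by $$(v_{i_1}\otimes\cdots\otimes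 v_{i_k})\,d=\sum v_{i_{1'}}\otimes\cdots\otimes v_{i_{k'}},$$ where the sum is over all $(i_{1'},\dots,i_{k'})\in\{1,\dots,n\}^k$ such that $i_a=i_b$ whenever $a,b\in\{1,\dots,k,1',\dots,k'\}$ lie in the same block of $d$. This action commutes with that of $\mathfrak S_n$, and $\sigma\in\mathfrak S_k$ acts by the place permutation $(v_{i_1}\otimes\cdots\otimes v_{i_k})\sigma=v_{i_{\sigma(1)}}\otimes\cdots\otimes v_{i_{\sigma(k)}}$. Let $S^kV_n=(V_n^{\otimes k})e_k$ be the symmetric power. It is a left $\mathbb C\mathfrak S_n$-module and, by restriction, a right $\mathcal{SP}_k(n)$-module, and the two actions commute. They give homomorphisms of $\mathbb C$-algebras $$\Upsilon_{sph}:\mathcal{SP}_k(n)\to \operatorname{End}_{\mathbb C\mathfrak S_n}(S^kV_n),\quad p\mapsto(v\mapsto vp),\qquad \Xi_{sph}:\mathbb C\mathfrak S_n\to\operatorname{End}_{\mathcal{SP}_k(n)}(S^kV_n),\quad x\mapsto(v\mapsto xv),$$ where in the first one the endomorphism algebra carries the opposite of composition, since the action is from the right. **Theorem.** a) $\Upsilon_{sph}$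 is surjective for all $k$ and $n$, and it is an isomorphism if $n\ge 2k$. b) $\Xi_{sph}$ is surjective for all $k$ and $n$. In other words, the actions of $\mathcal{SP}_k(n)$ and $\mathbb C\mathfrak S_n$ on $S^kV_n$ centralize each other. -/

import Mathlib

open scoped TensorProduct

namespace SphericalPartition

noncomputable section

/-! ### Set partitions and their concatenation -/

/-- Set partitions of `{1, …, k} ∪ {1', …, k'}`, given as equivalence relations. The left summand
is the top row `1, …, k`, the right summand is the bottom row `1', …, k'`. -/
abbrev SetPar (k : ℕ) : Type := Setoid (Fin k ⊕ Fin k)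

/-- The inclusion of the rows of the upper diagram in the three rows (top, middle, bottom) of a
concatenation. -/
def upper (k : ℕ) : Fin k ⊕ Fin k → Fin k ⊕ (Fin k ⊕ Fin k) :=
  Sum.elim Sum.inl (fun a => Sum.inr (Sum.inl a))

/-- The inclusion of the rows of the lower diagram in the three rows of a concatenation. -/
def lower (k : ℕ) : Fin k ⊕ Fin k → Fin k ⊕ (Fin k ⊕ Fin k) := Sum.inr

/-- The inclusion of the top and the bottom row in the three rows of a concatenation. -/
def outer (k : ℕ) : Fin k ⊕ Fin k → Fin k ⊕ (Fin k ⊕ Fin k) :=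
  Sum.elim Sum.inl (fun a => Sum.inr (Sum.inr a))

/-- The connected components of the concatenation of `d` (above) and `d₁` (below): the equivalence
relation on the three rows that is generated by `d` and `d₁`. -/
def stack {k : ℕ} (d d₁ : SetPar k) : Setoid (Fin k ⊕ (Fin k ⊕ Fin k)) :=
  d.map (upper k) ⊔ d₁.map (lower k)

/-- The set partition obtained from the concatenation of `d` and `d₁` by removing the middle row. -/
def concat {k : ℕ} (d d₁ : SetPar k) : SetPar k := (stack d d₁).comap (outer k)

/-- The number of internal components of the concatenation of `d` and `d₁`: those that do not meet
the top row or the bottom row. -/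
def loops {k : ℕ} (d d₁ : SetPar k) : ℕ :=
  Nat.card {c : Quotient (stack d d₁) // ∀ x, Quotient.mk (stack d d₁) (outer k x) ≠ c}

/-- The set partition of a permutation `σ`, with blocks `{σ r, r'}`. -/
def permDiagram {k : ℕ} (σ : Equiv.Perm (Fin k)) : SetPar k := Setoid.ker (Sum.elim id σ)

/-! ### The matrix of a set partition -/

open Classical in
/-- The matrix entry of the set partition `d` at multi-indices `i` (top row) and `j` (bottom row):
it is `1` if the labelling of the two rows by `i` and `j` is constant on the blocks of `d`, and `0`
otherwise. -/
def entry {k n : ℕ} (d : SetPar k) (i j : Fin k → Fin n) : ℕ :=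
  if d ≤ Setoid.ker (Sum.elim i j) then 1 else 0

lemma map_le_ker {X Y Z : Type*} (r : Setoid X) (f : X → Y) (g : Y → Z) :
    r.map f ≤ Setoid.ker g ↔ r ≤ Setoid.ker (g ∘ f) := by
  constructor
  · intro h x y hxy
    exact h (Setoid.le_comap_map hxy)
  · intro h
    refine Setoid.eqvGen_le ?_
    rintro _ _ ⟨x, y, hxy, rfl, rfl⟩
    exact h hxy

lemma stack_le_ker {k n : ℕ} (d d₁ : SetPar k) (i j l : Fin k → Fin n) :
    stack d d₁ ≤ Setoid.ker (Sum.elim i (Sum.elim j l)) ↔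
      d ≤ Setoid.ker (Sum.elim i j) ∧ d₁ ≤ Setoid.ker (Sum.elim j l) := by
  rw [stack, sup_le_iff, map_le_ker, map_le_ker]
  have h1 : Sum.elim i (Sum.elim j l) ∘ upper k = Sum.elim i j := by
    ext x; rcases x with x | x <;> rfl
  have h2 : Sum.elim i (Sum.elim j l) ∘ lower k = Sum.elim j l := by
    ext x; rcases x with x | x <;> rfl
  rw [h1, h2]

open Classical in
lemma entry_eq {k n : ℕ} (d : SetPar k) (i j : Fin k → Fin n) :
    entry d i j = if d ≤ Setoid.ker (Sum.elim i j) then 1 else 0 := rfl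

/-- Labellings of the middle row that are compatible with the stack are labellings of the internal
components, provided that the labelling of the outer rows is compatible with the concatenation. -/
lemma entry_mul {k n : ℕ} (d d₁ : SetPar k) (i l : Fin k → Fin n) :
    ∑ j, entry d i j * entry d₁ j l = n ^ loops d d₁ * entry (concat d d₁) i l := by
  classical
  have h1 : ∀ j : Fin k → Fin n, entry d i j * entry d₁ j l =
      if stack d d₁ ≤ Setoid.ker (Sum.elim i (Sum.elim j l)) then 1 else 0 := by
    intro j
    rw [entry_eq, entry_eq]
    by_cases ha : d ≤ Setoid.ker (Sum.elim i j) <;>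
      by_cases hb : d₁ ≤ Setoid.ker (Sum.elim j l) <;> simp [stack_le_ker, ha, hb]
  rw [Finset.sum_congr rfl (fun j _ => h1 j), Finset.sum_boole, Nat.cast_id, entry_eq]
  set J := stack d d₁ with hJ
  by_cases hc : concat d d₁ ≤ Setoid.ker (Sum.elim i l)
  · rw [if_pos hc, mul_one, loops, ← hJ]
    have hfin : Finite (Quotient J) := inferInstance
    let C := {c : Quotient J // ∀ x, Quotient.mk J (outer k x) ≠ c}
    have key : {j : Fin k → Fin n // J ≤ Setoid.ker (Sum.elim i (Sum.elim j l))} ≃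
        (C → Fin n) := by
      let lab : (C → Fin n) → Quotient J → Fin n := fun h c =>
        if hx : ∃ x, Quotient.mk J (outer k x) = c then Sum.elim i l hx.choose
        else h ⟨c, fun x hx' => hx ⟨x, hx'⟩⟩
      have lab_outer : ∀ h x, lab h (Quotient.mk J (outer k x)) = Sum.elim i l x := by
        intro h x
        have hx : ∃ y, Quotient.mk J (outer k y) = Quotient.mk J (outer k x) := ⟨x, rfl⟩
        simp only [lab, dif_pos hx]
        exact hc (show concat d d₁ _ _ from Quotient.exact (s := J) hx.choose_spec)
      have lab_eq : ∀ h : C → Fin n,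
          Sum.elim i (Sum.elim (fun a => lab h (Quotient.mk J (Sum.inr (Sum.inl a)))) l)
            = fun y => lab h (Quotient.mk J y) := by
        intro h
        funext y
        rcases y with y | y | y
        · exact (lab_outer h (Sum.inl y)).symm
        · rfl
        · exact (lab_outer h (Sum.inr y)).symm
      refine ⟨fun j c => Quotient.lift (s := J) (Sum.elim i (Sum.elim j.1 l))
          (fun a b hab => j.2 hab) c.1,
        fun h => ⟨fun a => lab h (Quotient.mk J (Sum.inr (Sum.inl a))), ?_⟩, ?_, ?_⟩
      · rw [lab_eq]
        intro a b hab
        exact congrArg (lab h) (Quotient.sound hab)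
      · rintro ⟨j, hj⟩
        ext a
        by_cases hx : ∃ x, Quotient.mk J (outer k x) = Quotient.mk J (Sum.inr (Sum.inl a))
        · have e1 : Sum.elim i (Sum.elim j l) (outer k hx.choose) = j a :=
            hj (Quotient.exact (s := J) hx.choose_spec)
          have e2 : Sum.elim i (Sum.elim j l) (outer k hx.choose) = Sum.elim i l hx.choose := by
            rcases hx.choose with y | y <;> rfl
          simp only [lab, dif_pos hx]
          rw [← e2, e1]
        · simp only [lab, dif_neg hx]
          rfl
      · intro h
        funext ⟨c, hcc⟩
        have hno : ¬ ∃ x, Quotient.mk J (outer k x) = c := fun ⟨x, hx⟩ => hcc x hx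
        induction c using Quotient.inductionOn with
        | h y =>
          show Sum.elim i (Sum.elim (fun a => lab h (Quotient.mk J (Sum.inr (Sum.inl a)))) l) y = _
          rw [lab_eq]
          simp only [lab, dif_neg hno]
    rw [← Fintype.card_subtype, ← Nat.card_eq_fintype_card, Nat.card_congr key, Nat.card_fun,
      Nat.card_fin]
  · rw [if_neg hc, mul_zero, Finset.card_eq_zero, Finset.filter_eq_empty_iff]
    intro j _ hj
    refine hc (fun {x y} hxy => ?_)
    have := hj hxy
    rcases x with x | x <;> rcases y with y | y <;> exact this

lemma entry_permDiagram {k n : ℕ} (σ : Equiv.Perm (Fin k)) (i j : Fin k → Fin n) :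
    entry (permDiagram σ) i j = if j = i ∘ σ then 1 else 0 := by
  classical
  rw [entry_eq]
  refine if_congr ?_ rfl rfl
  constructor
  · intro h
    funext r
    have : permDiagram σ (Sum.inr r) (Sum.inl (σ r)) := rfl
    exact h this
  · rintro rfl x y hxy
    rcases x with x | x <;> rcases y with y | y <;> exact congrArg i hxy

/-- A set partition, together with a power of `2`, is determined by its matrix for `n = 2`. -/
lemma entry_inj {k a b : ℕ} {d d₁ : SetPar k}
    (h : ∀ i j : Fin k → Fin 2, 2 ^ a * entry d i j = 2 ^ b * entry d₁ i j) : d = d₁ ∧ a = b := by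
  classical
  have hle : ∀ {a b : ℕ} {d d₁ : SetPar k},
      (∀ i j : Fin k → Fin 2, 2 ^ a * entry d i j = 2 ^ b * entry d₁ i j) → d ≤ d₁ := by
    intro a b d d₁ h x y hxy
    by_contra hn
    let f : Fin k ⊕ Fin k → Fin 2 := fun z => if d₁ x z then 0 else 1
    have hf : Sum.elim (fun r => f (Sum.inl r)) (fun r => f (Sum.inr r)) = f := by
      funext z; rcases z with z | z <;> rfl
    have h1 : d₁ ≤ Setoid.ker f := by
      intro u v huv
      have : d₁ x u ↔ d₁ x v := ⟨fun h => d₁.trans' h huv, fun h => d₁.trans' h (d₁.symm' huv)⟩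
      simp [Setoid.ker_def, f, this]
    have h2 : ¬ d ≤ Setoid.ker f := by
      intro hd
      have := hd hxy
      simp [Setoid.ker_def, f, hn] at this
    have := h (fun r => f (Sum.inl r)) (fun r => f (Sum.inr r))
    rw [entry_eq, entry_eq, hf, if_pos h1, if_neg h2, mul_zero, mul_one] at this
    exact (pow_pos two_pos b).ne this
  refine ⟨le_antisymm (hle h) (hle fun i j => (h i j).symm), ?_⟩
  have h0 := h (fun _ => 0) (fun _ => 0)
  have hk : Sum.elim (fun _ : Fin k => (0 : Fin 2)) (fun _ : Fin k => (0 : Fin 2)) = fun _ => 0 := by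
    funext z; rcases z with z | z <;> rfl
  have ht : ∀ d : SetPar k, d ≤ Setoid.ker (fun _ => (0 : Fin 2)) := fun d x y _ => rfl
  rw [entry_eq, entry_eq, hk, if_pos (ht _), if_pos (ht _), mul_one, mul_one] at h0
  exact Nat.pow_right_injective le_rfl h0

lemma concat_assoc {k : ℕ} (d d₁ d₂ : SetPar k) :
    concat (concat d d₁) d₂ = concat d (concat d₁ d₂) ∧
      loops d d₁ + loops (concat d d₁) d₂ = loops d₁ d₂ + loops d (concat d₁ d₂) := by
  refine entry_inj fun i j => ?_
  have hl : 2 ^ (loops d d₁ + loops (concat d d₁) d₂) * entry (concat (concat d d₁) d₂) i j =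
      ∑ b, ∑ a, entry d i a * entry d₁ a b * entry d₂ b j := by
    rw [pow_add, mul_assoc, ← entry_mul, Finset.mul_sum]
    refine Finset.sum_congr rfl fun b _ => ?_
    rw [← mul_assoc, ← entry_mul, Finset.sum_mul]
  have hr : 2 ^ (loops d₁ d₂ + loops d (concat d₁ d₂)) * entry (concat d (concat d₁ d₂)) i j =
      ∑ a, ∑ b, entry d i a * entry d₁ a b * entry d₂ b j := by
    rw [pow_add, mul_assoc, ← entry_mul, Finset.mul_sum]
    refine Finset.sum_congr rfl fun a _ => ?_
    rw [mul_left_comm, ← entry_mul, Finset.mul_sum]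
    simp_rw [mul_assoc]
  rw [hl, hr, Finset.sum_comm]

lemma concat_permDiagram {k : ℕ} (σ τ : Equiv.Perm (Fin k)) :
    concat (permDiagram σ) (permDiagram τ) = permDiagram (σ * τ) ∧
      loops (permDiagram σ) (permDiagram τ) = 0 := by
  refine entry_inj fun i j => ?_
  rw [← entry_mul]
  rw [Finset.sum_eq_single (i ∘ σ)]
  · rw [entry_permDiagram, entry_permDiagram, entry_permDiagram, if_pos rfl, one_mul, pow_zero,
      one_mul]
    rfl
  · intro b _ hb
    simp [entry_permDiagram, hb]
  · simp

lemma permDiagram_one_concat {k : ℕ} (d : SetPar k) :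
    concat (permDiagram 1) d = d ∧ loops (permDiagram 1) d = 0 := by
  refine entry_inj fun i j => ?_
  rw [← entry_mul]
  simp [entry_permDiagram]

lemma concat_permDiagram_one {k : ℕ} (d : SetPar k) :
    concat d (permDiagram 1) = d ∧ loops d (permDiagram 1) = 0 := by
  refine entry_inj fun i j => ?_
  rw [← entry_mul]
  simp [entry_permDiagram]

/-! ### The partition algebra and the spherical partition algebra -/

/-- The partition algebra with parameter `t` over `R`: the free `R`-module on the set partitions
of `{1, …, k} ∪ {1', …, k'}`, with product `d d₁ = t ^ N (d ∘ d₁)`, where `d ∘ d₁` is the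
concatenation of `d` (above) and `d₁` (below) and `N` is the number of its internal components. -/
def PartitionAlgebra (R : Type*) [CommRing R] (_t : R) (k : ℕ) : Type _ := SetPar k →₀ R

namespace PartitionAlgebra

variable {R : Type*} [CommRing R] {t : R} {k : ℕ}

instance : AddCommGroup (PartitionAlgebra R t k) := inferInstanceAs (AddCommGroup (SetPar k →₀ R))

instance : Module R (PartitionAlgebra R t k) := inferInstanceAs (Module R (SetPar k →₀ R))

/-- The basis of the partition algebra that consists of the set partitions. -/
def basis (R : Type*) [CommRing R] (t : R) (k : ℕ) :
    Module.Basis (SetPar k) R (PartitionAlgebra R t k) :=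
  (Finsupp.basisSingleOne : Module.Basis (SetPar k) R (SetPar k →₀ R))

/-- The multiplication of the partition algebra, as a bilinear map. -/
def mulMap (R : Type*) [CommRing R] (t : R) (k : ℕ) :
    PartitionAlgebra R t k →ₗ[R] PartitionAlgebra R t k →ₗ[R] PartitionAlgebra R t k :=
  (basis R t k).constr R fun d => (basis R t k).constr R fun d₁ =>
    t ^ loops d d₁ • basis R t k (concat d d₁)

lemma mulMap_basis (d d₁ : SetPar k) :
    mulMap R t k (basis R t k d) (basis R t k d₁) = t ^ loops d d₁ • basis R t k (concat d d₁) := by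
  simp [mulMap, Module.Basis.constr_basis]

lemma mulMap_assoc (p q r : PartitionAlgebra R t k) :
    mulMap R t k (mulMap R t k p q) r = mulMap R t k p (mulMap R t k q r) := by
  have h : (mulMap R t k).compr₂ (mulMap R t k) =
      (LinearMap.llcomp R _ _ _).flip (mulMap R t k) ∘ₗ
        (LinearMap.llcomp R (PartitionAlgebra R t k) (PartitionAlgebra R t k)
          (PartitionAlgebra R t k) ∘ₗ mulMap R t k) := by
    refine (basis R t k).ext fun d => (basis R t k).ext fun d₁ => (basis R t k).ext fun d₂ => ?_
    obtain ⟨h1, h2⟩ := concat_assoc d d₁ d₂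
    simp [mulMap_basis, smul_smul, ← pow_add, h1, h2]
  exact congrArg (fun f => f p q r) h

lemma one_mulMap (p : PartitionAlgebra R t k) :
    mulMap R t k (basis R t k (permDiagram 1)) p = p := by
  have h : mulMap R t k (basis R t k (permDiagram 1)) = LinearMap.id := by
    refine (basis R t k).ext fun d => ?_
    obtain ⟨h1, h2⟩ := permDiagram_one_concat d
    simp [mulMap_basis, h1, h2]
  exact congrArg (fun f => f p) h

lemma mulMap_one (p : PartitionAlgebra R t k) :
    mulMap R t k p (basis R t k (permDiagram 1)) = p := by
  have h : (mulMap R t k).flip (basis R t k (permDiagram 1)) = LinearMap.id := by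
    refine (basis R t k).ext fun d => ?_
    obtain ⟨h1, h2⟩ := concat_permDiagram_one d
    simp [mulMap_basis, h1, h2]
  exact congrArg (fun f => f p) h

instance : Ring (PartitionAlgebra R t k) :=
  { (inferInstance : AddCommGroup (PartitionAlgebra R t k)) with
    mul := fun p q => mulMap R t k p q
    one := basis R t k (permDiagram 1)
    left_distrib := fun p q r => map_add (mulMap R t k p) q r
    right_distrib := fun p q r => LinearMap.map_add₂ (mulMap R t k) p q r
    zero_mul := fun p => LinearMap.map_zero₂ (mulMap R t k) p
    mul_zero := fun p => map_zero (mulMap R t k p)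
    mul_assoc := mulMap_assoc
    one_mul := one_mulMap
    mul_one := mulMap_one }

lemma mul_def (p q : PartitionAlgebra R t k) : p * q = mulMap R t k p q := rfl

lemma one_def : (1 : PartitionAlgebra R t k) = basis R t k (permDiagram 1) := rfl

lemma basis_mul_basis (d d₁ : SetPar k) :
    basis R t k d * basis R t k d₁ = t ^ loops d d₁ • basis R t k (concat d d₁) :=
  mulMap_basis d d₁

instance : Algebra R (PartitionAlgebra R t k) :=
  Algebra.ofModule (fun r p q => LinearMap.map_smul₂ (mulMap R t k) r p q)
    (fun r p q => map_smul (mulMap R t k p) r q)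

/-- The inclusion of the group algebra of the symmetric group in the partition algebra. -/
def iota (R : Type*) [CommRing R] (t : R) (k : ℕ) :
    MonoidAlgebra R (Equiv.Perm (Fin k)) →ₐ[R] PartitionAlgebra R t k :=
  MonoidAlgebra.lift R _ _
    { toFun := fun σ => basis R t k (permDiagram σ)
      map_one' := rfl
      map_mul' := fun σ τ => by
        obtain ⟨h1, h2⟩ := concat_permDiagram σ τ
        rw [basis_mul_basis, h1, h2, pow_zero, one_smul] }

end PartitionAlgebra

/-- The symmetrizer `(1 / k!) ∑ σ` in the group algebra of the symmetric group. -/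
def symmetrizer (k : ℕ) : MonoidAlgebra ℂ (Equiv.Perm (Fin k)) :=
  (k.factorial : ℂ)⁻¹ • ∑ σ : Equiv.Perm (Fin k), MonoidAlgebra.of ℂ (Equiv.Perm (Fin k)) σ

lemma symmetrizer_idem (k : ℕ) : IsIdempotentElem (symmetrizer k) := by
  have hk : (k.factorial : ℂ) ≠ 0 := by exact_mod_cast k.factorial_ne_zero
  have h : ∀ σ : Equiv.Perm (Fin k), MonoidAlgebra.of ℂ (Equiv.Perm (Fin k)) σ *
      ∑ τ : Equiv.Perm (Fin k), MonoidAlgebra.of ℂ (Equiv.Perm (Fin k)) τ =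
      ∑ τ : Equiv.Perm (Fin k), MonoidAlgebra.of ℂ (Equiv.Perm (Fin k)) τ := by
    intro σ
    rw [Finset.mul_sum]
    simp_rw [← map_mul]
    exact Fintype.sum_equiv (Equiv.mulLeft σ) _ _ fun τ => rfl
  rw [IsIdempotentElem, symmetrizer, smul_mul_smul_comm, Finset.sum_mul,
    Finset.sum_congr rfl (fun σ _ => h σ), Finset.sum_const, Finset.card_univ, Fintype.card_perm,
    Fintype.card_fin, ← Nat.cast_smul_eq_nsmul ℂ, smul_smul, mul_assoc, inv_mul_cancel₀ hk, mul_one]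

/-- The idempotent `e_k` of the partition algebra. -/
def idem (t : ℂ) (k : ℕ) : PartitionAlgebra ℂ t k := PartitionAlgebra.iota ℂ t k (symmetrizer k)

lemma idem_idem (t : ℂ) (k : ℕ) : IsIdempotentElem (idem t k) :=
  (symmetrizer_idem k).map (PartitionAlgebra.iota ℂ t k)

/-- The spherical partition algebra `SP_k(t) = e_k P_k(t) e_k`, with unit element `e_k`. -/
abbrev SphericalAlgebra (t : ℂ) (k : ℕ) : Type := (idem_idem t k).Corner

instance (t : ℂ) (k : ℕ) : SMul ℂ (SphericalAlgebra t k) :=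
  ⟨fun c p => ⟨c • p.1, by
    obtain ⟨q, hq⟩ := p.2
    exact ⟨c • q, by rw [← hq]; simp⟩⟩⟩

instance (t : ℂ) (k : ℕ) : Module ℂ (SphericalAlgebra t k) where
  one_smul p := Subtype.ext (one_smul ℂ p.1)
  mul_smul a b p := Subtype.ext (mul_smul a b p.1)
  smul_zero a := Subtype.ext (smul_zero a)
  smul_add a p q := Subtype.ext (smul_add a p.1 q.1)
  add_smul a b p := Subtype.ext (add_smul a b p.1)
  zero_smul p := Subtype.ext (zero_smul ℂ p.1)

instance (t : ℂ) (k : ℕ) : Algebra ℂ (SphericalAlgebra t k) :=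
  Algebra.ofModule (fun c p q => Subtype.ext (smul_mul_assoc c p.1 q.1))
    (fun c p q => Subtype.ext (mul_smul_comm c p.1 q.1))

/-! ### The tensor power of the permutation representation -/

/-- The vector space `V_n` with basis `v_1, …, v_n`. -/
abbrev Space (n : ℕ) : Type := Fin n → ℂ

/-- The basis vector `v_i`. -/
abbrev vec {n : ℕ} (i : Fin n) : Space n := Pi.single i 1

/-- The action of the symmetric group on `V_n`, with `σ v_i = v_{σ i}`. -/
def permRep (n : ℕ) : Representation ℂ (Equiv.Perm (Fin n)) (Space n) where
  toFun σ := LinearMap.funLeft ℂ ℂ σ.symm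
  map_one' := rfl
  map_mul' _ _ := rfl

lemma permRep_vec {n : ℕ} (σ : Equiv.Perm (Fin n)) (i : Fin n) :
    permRep n σ (vec i) = vec (σ i) := by
  ext a
  change (Pi.single i 1 : Fin n → ℂ) (σ.symm a) = (Pi.single (σ i) 1 : Fin n → ℂ) a
  simp [Pi.single_apply, Equiv.symm_apply_eq]

/-- The tensor power of `V_n` with `k` factors. -/
def TensorSpace (k n : ℕ) : Type := ⨂[ℂ] _ : Fin k, Space n

instance (k n : ℕ) : AddCommGroup (TensorSpace k n) :=
  inferInstanceAs (AddCommGroup (⨂[ℂ] _ : Fin k, Space n))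

instance (k n : ℕ) : Module ℂ (TensorSpace k n) :=
  inferInstanceAs (Module ℂ (⨂[ℂ] _ : Fin k, Space n))

/-- The basis of the tensor power that consists of the tensors `v_{i_1} ⊗ ⋯ ⊗ v_{i_k}`. -/
def tensorBasis (k n : ℕ) : Module.Basis (Fin k → Fin n) ℂ (TensorSpace k n) :=
  (Basis.piTensorProduct fun _ : Fin k => Pi.basisFun ℂ (Fin n) :
    Module.Basis (Fin k → Fin n) ℂ (⨂[ℂ] _ : Fin k, Space n))

lemma tensorBasis_apply (k n : ℕ) (i : Fin k → Fin n) :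
    tensorBasis k n i = (PiTensorProduct.tprod ℂ fun r => vec (i r) : ⨂[ℂ] _ : Fin k, Space n) := by
  refine (Basis.piTensorProduct_apply _ i).trans ?_
  simp [vec]

/-- The diagonal action of the symmetric group on the tensor power. -/
def tensorRep (k n : ℕ) : Representation ℂ (Equiv.Perm (Fin n)) (TensorSpace k n) where
  toFun σ := (PiTensorProduct.map fun _ => permRep n σ :
    (⨂[ℂ] _ : Fin k, Space n) →ₗ[ℂ] ⨂[ℂ] _ : Fin k, Space n)
  map_one' := by
    rw [map_one]
    exact PiTensorProduct.map_one
  map_mul' σ τ := by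
    rw [map_mul]
    exact PiTensorProduct.map_mul (fun _ : Fin k => permRep n σ) fun _ => permRep n τ

lemma tensorRep_basis {k n : ℕ} (σ : Equiv.Perm (Fin n)) (i : Fin k → Fin n) :
    tensorRep k n σ (tensorBasis k n i) = tensorBasis k n (σ ∘ i) := by
  rw [tensorBasis_apply, tensorBasis_apply]
  refine (PiTensorProduct.map_tprod _ _).trans ?_
  simp [permRep_vec]

instance (k n : ℕ) : Module (MonoidAlgebra ℂ (Equiv.Perm (Fin n))) (TensorSpace k n) :=
  Module.compHom _ (tensorRep k n).asAlgebraHom.toRingHom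

lemma group_smul_def {k n : ℕ} (x : MonoidAlgebra ℂ (Equiv.Perm (Fin n))) (v : TensorSpace k n) :
    x • v = (tensorRep k n).asAlgebraHom x v := rfl

instance (k n : ℕ) : IsScalarTower ℂ (MonoidAlgebra ℂ (Equiv.Perm (Fin n))) (TensorSpace k n) :=
  ⟨fun c x v => by simp [group_smul_def]⟩

/-- The right action of the symmetric group by place permutation:
`(v_{i_1} ⊗ ⋯ ⊗ v_{i_k}) σ = v_{i_{σ(1)}} ⊗ ⋯ ⊗ v_{i_{σ(k)}}`. -/
def placePerm {k : ℕ} (n : ℕ) (σ : Equiv.Perm (Fin k)) : TensorSpace k n →ₗ[ℂ] TensorSpace k n :=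
  ((PiTensorProduct.reindex ℂ (fun _ : Fin k => Space n) σ.symm).toLinearMap :
    (⨂[ℂ] _ : Fin k, Space n) →ₗ[ℂ] ⨂[ℂ] _ : Fin k, Space n)

lemma placePerm_basis {k n : ℕ} (σ : Equiv.Perm (Fin k)) (i : Fin k → Fin n) :
    placePerm n σ (tensorBasis k n i) = tensorBasis k n (i ∘ σ) := by
  rw [tensorBasis_apply, tensorBasis_apply]
  exact PiTensorProduct.reindex_tprod _ _

/-! ### The action of the partition algebra on the tensor power -/

/-- The right action of the partition algebra `P_k(n)` on the tensor power, as a map to linear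
endomorphisms: a set partition `d` sends `v_{i_1} ⊗ ⋯ ⊗ v_{i_k}` to the sum of all
`v_{j_1} ⊗ ⋯ ⊗ v_{j_k}` such that labelling the top row by `i` and the bottom row by `j` is constant
on the blocks of `d`. -/
def upsilonLin (k n : ℕ) : PartitionAlgebra ℂ (n : ℂ) k →ₗ[ℂ] Module.End ℂ (TensorSpace k n) :=
  (PartitionAlgebra.basis ℂ (n : ℂ) k).constr ℂ fun d => (tensorBasis k n).constr ℂ fun i =>
    ∑ j, (entry d i j : ℂ) • tensorBasis k n j

lemma upsilonLin_basis {k n : ℕ} (d : SetPar k) (i : Fin k → Fin n) :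
    upsilonLin k n (PartitionAlgebra.basis ℂ (n : ℂ) k d) (tensorBasis k n i) =
      ∑ j, (entry d i j : ℂ) • tensorBasis k n j := by
  simp [upsilonLin, Module.Basis.constr_basis]

lemma upsilonLin_perm {k n : ℕ} (σ : Equiv.Perm (Fin k)) :
    upsilonLin k n (PartitionAlgebra.basis ℂ (n : ℂ) k (permDiagram σ)) = placePerm n σ := by
  refine (tensorBasis k n).ext fun i => ?_
  rw [upsilonLin_basis, placePerm_basis]
  simp [entry_permDiagram]

lemma upsilonLin_one (k n : ℕ) : upsilonLin k n 1 = 1 := by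
  rw [PartitionAlgebra.one_def, upsilonLin_perm]
  refine (tensorBasis k n).ext fun i => ?_
  rw [placePerm_basis]
  rfl

lemma upsilonLin_mul {k n : ℕ} (p q : PartitionAlgebra ℂ (n : ℂ) k) :
    upsilonLin k n (p * q) = upsilonLin k n q * upsilonLin k n p := by
  have h : (PartitionAlgebra.mulMap ℂ (n : ℂ) k).compr₂ (upsilonLin k n) =
      ((LinearMap.mul ℂ (Module.End ℂ (TensorSpace k n))).flip.compl₁₂ (upsilonLin k n)
        (upsilonLin k n)) := by
    refine (PartitionAlgebra.basis ℂ (n : ℂ) k).ext fun d =>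
      (PartitionAlgebra.basis ℂ (n : ℂ) k).ext fun d₁ => (tensorBasis k n).ext fun i => ?_
    simp only [LinearMap.compr₂_apply, PartitionAlgebra.mulMap_basis, map_smul,
      LinearMap.smul_apply, upsilonLin_basis, LinearMap.compl₁₂_apply, LinearMap.flip_apply,
      LinearMap.mul_apply', Module.End.mul_apply, map_sum, Finset.smul_sum, smul_smul]
    rw [Finset.sum_comm]
    refine Finset.sum_congr rfl fun l _ => ?_
    rw [← Finset.sum_smul]
    congr 1
    exact_mod_cast (entry_mul d d₁ i l).symm
  exact congrArg (fun f => f p q) h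

/-- The algebra homomorphism from `P_k(n)` to the endomorphisms of the tensor power, with the
opposite multiplication since the action is from the right. -/
def upsilon (k n : ℕ) : (PartitionAlgebra ℂ (n : ℂ) k)ᵐᵒᵖ →ₐ[ℂ] Module.End ℂ (TensorSpace k n) :=
  AlgHom.ofLinearMap (upsilonLin k n ∘ₗ (MulOpposite.opLinearEquiv ℂ).symm.toLinearMap)
    (upsilonLin_one k n) fun p q => upsilonLin_mul q.unop p.unop

/-- The tensor power is a right module over `P_k(n)`. -/
instance (k n : ℕ) : Module (PartitionAlgebra ℂ (n : ℂ) k)ᵐᵒᵖ (TensorSpace k n) :=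
  Module.compHom _ (upsilon k n).toRingHom

lemma op_smul_def {k n : ℕ} (p : PartitionAlgebra ℂ (n : ℂ) k) (v : TensorSpace k n) :
    MulOpposite.op p • v = upsilonLin k n p v := rfl

lemma entry_perm {k n : ℕ} (d : SetPar k) (σ : Equiv.Perm (Fin n)) (i j : Fin k → Fin n) :
    entry d (σ ∘ i) (σ ∘ j) = entry d i j := by
  have h : Setoid.ker (Sum.elim (σ ∘ i) (σ ∘ j)) = Setoid.ker (Sum.elim i j) := by
    ext x y
    rcases x with x | x <;> rcases y with y | y <;> simp [Setoid.ker_def]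
  rw [entry_eq, entry_eq, h]

lemma upsilonLin_comm_rep {k n : ℕ} (p : PartitionAlgebra ℂ (n : ℂ) k)
    (σ : Equiv.Perm (Fin n)) :
    upsilonLin k n p ∘ₗ tensorRep k n σ = tensorRep k n σ ∘ₗ upsilonLin k n p := by
  have h : LinearMap.lcomp ℂ (TensorSpace k n) (tensorRep k n σ) ∘ₗ upsilonLin k n =
      LinearMap.llcomp ℂ _ _ _ (tensorRep k n σ) ∘ₗ upsilonLin k n := by
    refine (PartitionAlgebra.basis ℂ (n : ℂ) k).ext fun d => (tensorBasis k n).ext fun i => ?_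
    simp only [LinearMap.comp_apply, LinearMap.lcomp_apply, LinearMap.llcomp_apply,
      tensorRep_basis, upsilonLin_basis, map_sum, map_smul]
    refine (Fintype.sum_equiv (Equiv.arrowCongr (Equiv.refl (Fin k)) σ) _ _ fun j => ?_).symm
    have : (Equiv.arrowCongr (Equiv.refl (Fin k)) σ) j = σ ∘ j := rfl
    rw [this, entry_perm]
  exact congrArg (fun f => f p) h

/-- The actions of the group algebra and of the partition algebra commute. -/
instance (k n : ℕ) : SMulCommClass (PartitionAlgebra ℂ (n : ℂ) k)ᵐᵒᵖ
    (MonoidAlgebra ℂ (Equiv.Perm (Fin n))) (TensorSpace k n) :=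
  ⟨fun p x v => by
    induction x using MonoidAlgebra.induction_on with
    | of σ =>
      simp only [group_smul_def, Representation.asAlgebraHom_of]
      exact congrArg (fun f => f v) (upsilonLin_comm_rep p.unop σ)
    | add x y hx hy => rw [add_smul, add_smul, smul_add, hx, hy]
    | smul c x hx =>
      rw [smul_assoc, smul_assoc, ← hx]
      exact map_smul (upsilonLin k n p.unop) c (x • v)⟩

/-! ### The symmetric power -/

/-- The right action of `e_k`, that is the average of all place permutations. It is linear over the
group algebra of the symmetric group on `n` letters. -/
def symmetrize (k n : ℕ) :
    TensorSpace k n →ₗ[MonoidAlgebra ℂ (Equiv.Perm (Fin n))] TensorSpace k n where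
  toFun v := (k.factorial : ℂ)⁻¹ • ∑ σ : Equiv.Perm (Fin k), placePerm n σ v
  map_add' v w := by simp [Finset.sum_add_distrib]
  map_smul' x v := by
    have h : ∀ (σ : Equiv.Perm (Fin k)) (w : TensorSpace k n), placePerm n σ w =
        MulOpposite.op (PartitionAlgebra.basis ℂ (n : ℂ) k (permDiagram σ)) • w := by
      intro σ w
      rw [op_smul_def, upsilonLin_perm]
    simp only [h, RingHom.id_apply]
    rw [smul_comm x ((k.factorial : ℂ)⁻¹), Finset.smul_sum (r := x)]
    exact congrArg _ (Finset.sum_congr rfl fun σ _ =>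
      smul_comm (MulOpposite.op (PartitionAlgebra.basis ℂ (n : ℂ) k (permDiagram σ))) x v)

lemma symmetrize_eq {k n : ℕ} (v : TensorSpace k n) :
    symmetrize k n v = MulOpposite.op (idem (n : ℂ) k) • v := by
  rw [op_smul_def]
  simp [idem, symmetrizer, PartitionAlgebra.iota, symmetrize, upsilonLin_perm, -map_inv₀]

/-- The symmetric power `S^k V_n = (V_n^{⊗ k}) e_k`, as a submodule over the group algebra of the
symmetric group on `n` letters. -/
def SymPower (k n : ℕ) : Submodule (MonoidAlgebra ℂ (Equiv.Perm (Fin n))) (TensorSpace k n) :=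
  LinearMap.range (symmetrize k n)

lemma op_smul_mem {k n : ℕ} (p : SphericalAlgebra (n : ℂ) k) (v : TensorSpace k n) :
    MulOpposite.op p.1 • v ∈ SymPower k n := by
  have h := ((Subsemigroup.mem_corner_iff (idem_idem (n : ℂ) k)).mp p.2).2
  refine ⟨MulOpposite.op p.1 • v, ?_⟩
  rw [symmetrize_eq, smul_smul, ← MulOpposite.op_mul, h]

lemma idem_smul {k n : ℕ} {v : TensorSpace k n} (hv : v ∈ SymPower k n) :
    MulOpposite.op (idem (n : ℂ) k) • v = v := by
  obtain ⟨w, rfl⟩ := hv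
  rw [symmetrize_eq, smul_smul, ← MulOpposite.op_mul, (idem_idem (n : ℂ) k).eq]

/-- The symmetric power is a right module over `SP_k(n)`, by restriction of the action of `P_k(n)`
on the tensor power. -/
instance (k n : ℕ) : Module (SphericalAlgebra (n : ℂ) k)ᵐᵒᵖ (SymPower k n) where
  smul p v := ⟨MulOpposite.op p.unop.1 • v.1, op_smul_mem p.unop v.1⟩
  one_smul v := Subtype.ext (idem_smul v.2)
  mul_smul p q v := Subtype.ext
    (mul_smul (MulOpposite.op p.unop.1) (MulOpposite.op q.unop.1) v.1)
  smul_zero p := Subtype.ext (smul_zero (MulOpposite.op p.unop.1))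
  smul_add p v w := Subtype.ext (smul_add (MulOpposite.op p.unop.1) v.1 w.1)
  add_smul p q v := Subtype.ext (add_smul (MulOpposite.op p.unop.1) (MulOpposite.op q.unop.1) v.1)
  zero_smul v := Subtype.ext (zero_smul (PartitionAlgebra ℂ (n : ℂ) k)ᵐᵒᵖ v.1)

lemma coe_op_smul {k n : ℕ} (p : SphericalAlgebra (n : ℂ) k) (v : SymPower k n) :
    ((MulOpposite.op p • v : SymPower k n) : TensorSpace k n) = MulOpposite.op p.1 • v.1 := rfl

instance (k n : ℕ) : IsScalarTower ℂ (SphericalAlgebra (n : ℂ) k)ᵐᵒᵖ (SymPower k n) :=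
  ⟨fun c p v => Subtype.ext (congrArg (fun f => f v.1) (map_smul (upsilonLin k n) c p.unop.1))⟩

/-- The actions of `SP_k(n)` and of the symmetric group on the symmetric power commute. -/
instance (k n : ℕ) : SMulCommClass (SphericalAlgebra (n : ℂ) k)ᵐᵒᵖ
    (MonoidAlgebra ℂ (Equiv.Perm (Fin n))) (SymPower k n) :=
  ⟨fun p x v => Subtype.ext (smul_comm (MulOpposite.op p.unop.1) x v.1)⟩

instance (k n : ℕ) : SMulCommClass (MonoidAlgebra ℂ (Equiv.Perm (Fin n)))
    (SphericalAlgebra (n : ℂ) k)ᵐᵒᵖ (SymPower k n) :=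
  SMulCommClass.symm _ _ _

/-- The algebra homomorphism `SP_k(n) → End_{ℂ S_n}(S^k V_n)`, `p ↦ (v ↦ v p)`. Since the action is
from the right, the multiplication of the endomorphism algebra is the opposite one. -/
def upsilonSph (k n : ℕ) : SphericalAlgebra (n : ℂ) k →ₐ[ℂ]
    (Module.End (MonoidAlgebra ℂ (Equiv.Perm (Fin n))) (SymPower k n))ᵐᵒᵖ :=
  AlgHom.opComm.symm
    (Algebra.lsmul ℂ (MonoidAlgebra ℂ (Equiv.Perm (Fin n))) (SymPower k n))

lemma upsilonSph_apply {k n : ℕ} (p : SphericalAlgebra (n : ℂ) k) (v : SymPower k n) :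
    (upsilonSph k n p).unop v = MulOpposite.op p • v := rfl

/-- The algebra homomorphism `ℂ S_n → End_{SP_k(n)}(S^k V_n)`, `x ↦ (v ↦ x v)`. -/
def xiSph (k n : ℕ) : MonoidAlgebra ℂ (Equiv.Perm (Fin n)) →ₐ[ℂ]
    Module.End (SphericalAlgebra (n : ℂ) k)ᵐᵒᵖ (SymPower k n) :=
  Algebra.lsmul ℂ (SphericalAlgebra (n : ℂ) k)ᵐᵒᵖ (SymPower k n)

lemma xiSph_apply {k n : ℕ} (x : MonoidAlgebra ℂ (Equiv.Perm (Fin n))) (v : SymPower k n) :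
    xiSph k n x v = x • v := rfl

end

end SphericalPartition

open SphericalPartition

/-! The symmetric group acts on the basis tensors by relabelling, so a linear endomorphism of the
tensor power commutes with it exactly when its matrix entry at `(i, j)` is invariant under
relabelling. Two labellings of the `2k` points by `n` letters are related by a permutation of the
letters if and only if they have the same kernel (`exists_perm_comp_eq_of_ker_eq`). Such a matrix is
therefore a function on those set partitions that are kernels, namely those with at most `n` blocks.

The matrix entry of `∑ c_d d` at `(i, j)` is the sum of the `c_d` over all `d` finer than the kernel
of `(i, j)`, which is a value of the zeta transform of `c` on the refinement order
(`upsilonLin_repr`). The zeta transform of a finite poset is invertible. Hence every commuting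
endomorphism comes from `P_k(n)`, and if `n ≥ 2k`, so that every set partition is a kernel, the
element is determined by its matrix.

Cutting with `e_k` on both sides transfers this to the symmetric power and gives a). Part b) is then
the double centralizer property: `ℂ S_n` is semisimple by Maschke, so it surjects onto the
bicommutant of its action, and by a) commuting with `SP_k(n)` is the same as commuting with all of
the centralizer of `ℂ S_n`. -/

/-! ### The zeta transform of a finite partial order -/

/-- The zeta transform `c ↦ (x ↦ ∑ y ≤ x, c y)` on functions on a finite partial order. -/
noncomputable def zetaTransform (K P : Type*) [Field K] [PartialOrder P] [Fintype P] :
    (P → K) →ₗ[K] (P → K) := by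
  classical
  exact
    { toFun := fun c x => ∑ y, if y ≤ x then c y else 0
      map_add' := fun c c' => by
        ext x
        simp only [Pi.add_apply, ← Finset.sum_add_distrib]
        refine Finset.sum_congr rfl fun y _ => ?_
        split_ifs <;> simp
      map_smul' := fun a c => by
        ext x
        simp [Finset.mul_sum] }

open Classical in
lemma zetaTransform_apply {K P : Type*} [Field K] [PartialOrder P] [Fintype P] (c : P → K)
    (x : P) : zetaTransform K P c x = ∑ y, if y ≤ x then c y else 0 := by
  simp only [zetaTransform, LinearMap.coe_mk, AddHom.coe_mk]

/-- The transform is unitriangular with respect to the order, so its kernel vanishes by well-founded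
induction from the minimal elements upwards. -/
lemma zetaTransform_injective (K P : Type*) [Field K] [PartialOrder P] [Fintype P] :
    Function.Injective (zetaTransform K P) := by
  classical
  rw [← LinearMap.ker_eq_bot, LinearMap.ker_eq_bot']
  intro c hc
  funext x
  induction x using WellFoundedLT.induction with
  | ind x ih =>
    -- All terms with `y < x` vanish by induction, so only `c x` survives in the sum.
    have h := congrFun hc x
    rw [zetaTransform_apply, Finset.sum_eq_single x] at h
    · simpa using h
    · intro y _ hy
      split_ifs with hyx
      · exact ih y (lt_of_le_of_ne hyx hy)
      · rfl
    · simp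

lemma zetaTransform_surjective (K P : Type*) [Field K] [PartialOrder P] [Fintype P] :
    Function.Surjective (zetaTransform K P) :=
  LinearMap.injective_iff_surjective.mp (zetaTransform_injective K P)

/-! ### Labellings with a given kernel -/

/-- Two maps to a finite set with the same kernel differ by a permutation of the target. -/
lemma exists_perm_comp_eq_of_ker_eq {X Y : Type*} [Finite Y] {f g : X → Y}
    (h : Setoid.ker f = Setoid.ker g) : ∃ σ : Equiv.Perm Y, σ ∘ f = g := by
  classical
  have := Fintype.ofFinite Y
  -- Both ranges are copies of the same quotient of `X`; `e` matches `f x` with `g x`.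
  let e : Set.range f ≃ Set.range g := (Setoid.quotientKerEquivRange f).symm.trans
    ((Quotient.congrRight fun a b => iff_of_eq (congrArg (fun s : Setoid X => s a b) h)).trans
      (Setoid.quotientKerEquivRange g))
  -- Since `Y` is finite, the complements of the two ranges have equal cardinality, so `e` extends
  -- to a permutation.
  refine ⟨Equiv.extendSubtype (p := (· ∈ Set.range f)) (q := (· ∈ Set.range g)) e, ?_⟩
  funext x
  have hx : (Setoid.quotientKerEquivRange f).symm ⟨f x, x, rfl⟩ = Quotient.mk _ x := by
    rw [Equiv.symm_apply_eq]
    rfl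
  rw [Function.comp_apply, Equiv.extendSubtype_apply_of_mem _ _ ⟨x, rfl⟩]
  simp only [e, Equiv.trans_apply, hx]
  rfl

/-- Every equivalence relation on a finite set is the kernel of a map to any larger finite set. -/
lemma Setoid.exists_ker_eq {X : Type*} [Fintype X] {n : ℕ} (hn : Fintype.card X ≤ n)
    (d : Setoid X) : ∃ f : X → Fin n, Setoid.ker f = d := by
  classical
  have hc : Fintype.card (Quotient d) ≤ Fintype.card (Fin n) := by
    rw [Fintype.card_fin]
    exact (Fintype.card_quotient_le d).trans hn
  obtain ⟨φ⟩ := Function.Embedding.nonempty_of_card_le hc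
  refine ⟨fun x => φ (Quotient.mk d x), ?_⟩
  ext x y
  rw [Setoid.ker_def, φ.injective.eq_iff]
  exact Quotient.eq

namespace SphericalPartition

/-! ### The action of the partition algebra on the tensor power -/

noncomputable instance (k : ℕ) : Fintype (SetPar k) :=
  have : Finite (SetPar k) := Finite.of_injective
    (fun (d : SetPar k) (x y : Fin k ⊕ Fin k) => d x y)
    fun _ _ h => Setoid.ext fun x y => iff_of_eq (congrFun (congrFun h x) y)
  Fintype.ofFinite _

/-- The matrix entries of an element of the partition algebra are values of the zeta transform of
its coordinates. -/
lemma upsilonLin_repr {k n : ℕ} (p : PartitionAlgebra ℂ (n : ℂ) k) (i j : Fin k → Fin n) :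
    (tensorBasis k n).repr (upsilonLin k n p (tensorBasis k n i)) j =
      zetaTransform ℂ (SetPar k) ((PartitionAlgebra.basis ℂ (n : ℂ) k).repr p)
        (Setoid.ker (Sum.elim i j)) := by
  classical
  conv_lhs => rw [← (PartitionAlgebra.basis ℂ (n : ℂ) k).sum_repr p]
  simp only [map_sum, map_smul, LinearMap.sum_apply, LinearMap.smul_apply, upsilonLin_basis,
    Finsupp.coe_finsetSum, Finset.sum_apply, Finsupp.smul_apply, Module.Basis.repr_self,
    smul_eq_mul, zetaTransform_apply]
  refine Finset.sum_congr rfl fun d _ => ?_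
  rw [Finset.sum_eq_single j (fun b _ hb => by simp [hb]) (by simp), entry_eq]
  split_ifs <;> simp

/-- Every endomorphism of the tensor power that commutes with the symmetric group comes from the
partition algebra. -/
lemma exists_upsilonLin_eq {k n : ℕ} (ψ : Module.End ℂ (TensorSpace k n))
    (hψ : ∀ σ, ψ ∘ₗ tensorRep k n σ = tensorRep k n σ ∘ₗ ψ) : ∃ p, upsilonLin k n p = ψ := by
  classical
  -- The matrix of `ψ`, with row and column index combined into one labelling of the `2k` points.
  let M : (Fin k ⊕ Fin k → Fin n) → ℂ := fun f =>
    (tensorBasis k n).repr (ψ (tensorBasis k n (f ∘ Sum.inl))) (f ∘ Sum.inr)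
  have hrepr : ∀ (σ : Equiv.Perm (Fin n)) (v : TensorSpace k n) (j : Fin k → Fin n),
      (tensorBasis k n).repr (tensorRep k n σ v) (σ ∘ j) = (tensorBasis k n).repr v j := by
    intro σ v j
    have hinj : Function.Injective fun i : Fin k → Fin n => σ ∘ i := σ.injective.comp_left
    conv_lhs => rw [← (tensorBasis k n).sum_repr v]
    simp only [map_sum, map_smul, tensorRep_basis, Finsupp.coe_finsetSum, Finset.sum_apply,
      Finsupp.smul_apply, Module.Basis.repr_self, smul_eq_mul]
    rw [Finset.sum_eq_single j (fun b _ hb => by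
      rw [Finsupp.single_eq_of_ne (fun h => hb (hinj h).symm), mul_zero]) (by simp)]
    simp
  have hM : ∀ (σ : Equiv.Perm (Fin n)) f, M (σ ∘ f) = M f := by
    intro σ f
    have h := LinearMap.congr_fun (hψ σ) (tensorBasis k n (f ∘ Sum.inl))
    simp only [LinearMap.comp_apply, tensorRep_basis] at h
    change (tensorBasis k n).repr (ψ (tensorBasis k n (σ ∘ (f ∘ Sum.inl)))) (σ ∘ (f ∘ Sum.inr)) = _
    rw [h, hrepr]
  have hfac : Function.FactorsThrough M Setoid.ker := fun f g hfg => by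
    obtain ⟨σ, rfl⟩ := exists_perm_comp_eq_of_ker_eq hfg
    exact (hM σ f).symm
  -- The target function is `M` on kernels. Set partitions with more than `n` blocks are not
  -- kernels, so the value `0` chosen for them never shows up as a matrix entry.
  obtain ⟨c, hc⟩ := zetaTransform_surjective ℂ (SetPar k)
    (Function.extend (Setoid.ker (α := Fin k ⊕ Fin k) (β := Fin n)) M 0)
  refine ⟨(PartitionAlgebra.basis ℂ (n : ℂ) k).equivFun.symm c, ?_⟩
  refine (tensorBasis k n).ext fun i => (tensorBasis k n).ext_elem fun j => ?_
  have hcoe : ⇑((PartitionAlgebra.basis ℂ (n : ℂ) k).repr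
      ((PartitionAlgebra.basis ℂ (n : ℂ) k).equivFun.symm c)) = c :=
    (PartitionAlgebra.basis ℂ (n : ℂ) k).equivFun.apply_symm_apply c
  rw [upsilonLin_repr, hcoe, hc, hfac.extend_apply]
  rfl

/-- The action of `P_k(n)` on the tensor power is faithful if `n ≥ 2 k`. -/
lemma upsilonLin_injective {k n : ℕ} (hn : 2 * k ≤ n) : Function.Injective (upsilonLin k n) := by
  rw [← LinearMap.ker_eq_bot, LinearMap.ker_eq_bot']
  intro p hp
  have hz : zetaTransform ℂ (SetPar k) ((PartitionAlgebra.basis ℂ (n : ℂ) k).repr p) = 0 := by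
    funext d
    -- There are `2k` points and at least as many letters, so each set partition `d` occurs as an
    -- index of a matrix entry.
    obtain ⟨f, rfl⟩ := Setoid.exists_ker_eq (n := n) (by simpa [← two_mul] using hn) d
    have h := upsilonLin_repr p (f ∘ Sum.inl) (f ∘ Sum.inr)
    rw [Sum.elim_comp_inl_inr] at h
    rw [← h, hp]
    simp
  have h0 := zetaTransform_injective ℂ (SetPar k) (hz.trans (map_zero _).symm)
  exact (PartitionAlgebra.basis ℂ (n : ℂ) k).repr.map_eq_zero_iff.mp (DFunLike.coe_injective h0)

/-! ### The action of the spherical partition algebra on the symmetric power -/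

lemma tensorRep_eq_smul {k n : ℕ} (σ : Equiv.Perm (Fin n)) (v : TensorSpace k n) :
    tensorRep k n σ v = MonoidAlgebra.of ℂ (Equiv.Perm (Fin n)) σ • v := by
  rw [group_smul_def, Representation.asAlgebraHom_of]

lemma symmetrize_mem {k n : ℕ} (v : TensorSpace k n) : symmetrize k n v ∈ SymPower k n :=
  ⟨v, rfl⟩

lemma symmetrize_of_mem {k n : ℕ} {v : TensorSpace k n} (hv : v ∈ SymPower k n) :
    symmetrize k n v = v := by
  rw [symmetrize_eq, idem_smul hv]

/-- An endomorphism `φ` of the symmetric power extends to the tensor power as `v ↦ φ (v e_k)`. If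
`p` in `P_k(n)` induces this extension, then `e_k p e_k` induces `φ`. -/
lemma upsilonSph_surjective (k n : ℕ) : Function.Surjective (upsilonSph k n) := by
  intro φ
  let ψ : TensorSpace k n →ₗ[MonoidAlgebra ℂ (Equiv.Perm (Fin n))] TensorSpace k n :=
    (SymPower k n).subtype ∘ₗ φ.unop ∘ₗ (symmetrize k n).rangeRestrict
  obtain ⟨p, hp⟩ := exists_upsilonLin_eq (ψ.restrictScalars ℂ) fun σ => by
    ext v
    simp only [LinearMap.comp_apply, LinearMap.restrictScalars_apply, tensorRep_eq_smul, map_smul]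
  let q : SphericalAlgebra (n : ℂ) k := ⟨idem (n : ℂ) k * p * idem (n : ℂ) k, p, rfl⟩
  refine ⟨q, MulOpposite.unop_injective (LinearMap.ext fun v => Subtype.ext ?_)⟩
  rw [upsilonSph_apply, coe_op_smul]
  change MulOpposite.op (idem (n : ℂ) k * p * idem (n : ℂ) k) • v.1 = _
  rw [MulOpposite.op_mul, MulOpposite.op_mul, mul_smul, mul_smul,
    idem_smul v.2, op_smul_def p, hp]
  have hv : (symmetrize k n).rangeRestrict v.1 = v := Subtype.ext (symmetrize_of_mem v.2)
  change MulOpposite.op (idem (n : ℂ) k) • (φ.unop ((symmetrize k n).rangeRestrict v.1)).1 = _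
  rw [hv, idem_smul (φ.unop v).2]

/-- Since `p = e_k p`, one has `v p = (v e_k) p`. So an element that kills the symmetric power kills
the whole tensor power, where the action is faithful. -/
lemma upsilonSph_injective {k n : ℕ} (hn : 2 * k ≤ n) :
    Function.Injective (upsilonSph k n) := by
  rw [injective_iff_map_eq_zero]
  intro p hp
  refine Subtype.ext (upsilonLin_injective hn ?_)
  refine LinearMap.ext fun v => ?_
  have h1 := ((Subsemigroup.mem_corner_iff (idem_idem (n : ℂ) k)).mp p.2).1
  have h2 := upsilonSph_apply p ⟨symmetrize k n v, symmetrize_mem v⟩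
  rw [hp] at h2
  have h3 : (0 : TensorSpace k n) = MulOpposite.op p.1 • symmetrize k n v := congrArg Subtype.val h2
  rw [symmetrize_eq, smul_smul, ← MulOpposite.op_mul, h1] at h3
  exact h3.symm.trans (zero_smul (PartitionAlgebra ℂ (n : ℂ) k)ᵐᵒᵖ v).symm

/-! ### The double centralizer argument -/

instance (k n : ℕ) : Module.Finite ℂ (SymPower k n) :=
  have : Module.Finite ℂ (TensorSpace k n) := .of_basis (tensorBasis k n)
  inferInstanceAs (Module.Finite ℂ ((SymPower k n).restrictScalars ℂ))

/-- The double centralizer property for the group algebra, which is semisimple. -/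
lemma xiSph_surjective (k n : ℕ) : Function.Surjective (xiSph k n) := by
  intro f
  -- Maschke's condition: the group order is nonzero in `ℂ`, which makes the symmetric power a
  -- semisimple module.
  have : NeZero (Nat.card (Equiv.Perm (Fin n)) : ℂ) := ⟨by simp⟩
  have : Module.Finite (Module.End (MonoidAlgebra ℂ (Equiv.Perm (Fin n))) (SymPower k n))
      (SymPower k n) := .of_restrictScalars_finite ℂ _ _
  -- Every `ℂ S_n`-endomorphism `g` is the action of some `p` in `SP_k(n)`, and `f` commutes with
  -- `p`; hence `f` lies in the bicommutant.
  let F : Module.End (Module.End (MonoidAlgebra ℂ (Equiv.Perm (Fin n))) (SymPower k n))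
      (SymPower k n) :=
    { toFun := f
      map_add' := map_add f
      map_smul' := fun g v => by
        obtain ⟨p, hp⟩ := upsilonSph_surjective k n (MulOpposite.op g)
        have hg : ∀ w, g w = MulOpposite.op p • w := fun w => by rw [← upsilonSph_apply, hp]; rfl
        simp only [Module.End.smul_def, hg, map_smul, RingHom.id_apply] }
  -- Jacobson density: for a semisimple module that is finite over its endomorphism ring, the
  -- bicommutant is the image of the ring.
  obtain ⟨x, hx⟩ := Module.Finite.toModuleEnd_moduleEnd_surjective F
  exact ⟨x, LinearMap.ext fun v => LinearMap.congr_fun hx v⟩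

end SphericalPartition

theorem theorem6p4 (k n : ℕ) :
    (Function.Surjective (SphericalPartition.upsilonSph k n) ∧
      (2 * k ≤ n → Function.Bijective (SphericalPartition.upsilonSph k n))) ∧
    Function.Surjective (SphericalPartition.xiSph k n) :=
  ⟨⟨upsilonSph_surjective k n, fun hn => ⟨upsilonSph_injective hn, upsilonSph_surjective k n⟩⟩,
    xiSph_surjective k n⟩
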